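/- Let $M\subset\mathbf R^s$ be a compact $m$-dimensional smooth submanifold without boundary. Let the cutlocus $C$ of $M$ be the set of all $x\in\mathbf R^s$ for which either the minimiser over $M$ of $L_x(\mu)=\|\mu-x\|^2$ is not unique, or the function $L_x$ on $M$ has a degenerate second derivative (Hessian) at this minimiser. For $x\in\mathbf R^s\setminus C$ let $\pi(x)\in M$ be the unique nearest point of $M$ to $x$. Let $d(x,A)$ be the Euclidean distance from $x$ to the set $A$ (with $d(x,\emptyset)=+\infty$). Let $t_n\in\mathbf R^s$ be a sequence of points, let $\tilde t_n$ be random vectors in $\mathbf R^s$ (possibly defined on different probability spaces), and let $B_n$ be nonsingular real $s\times s$ matrices with $B_n\to 0$, such that $$B_n^{-1}(\tilde t_n-t_n)\xrightarrow{\mathcal D} Z\qquad (n\to\infty)$$ for some random vector $Z$ in $\mathbf R^s$. Suppose that $t_n\notin C$ for all $n$, that there is $D>0$ with $d(t_n,M)\le D$ for all $n$, and that $$\frac{B_n}{d(t_n,C)}\to 0 .$$ Put $\mu_n=\pi(t_n)$ and let $\tilde\mu_n$ be equal to $\pi(\tilde t_n)$ on the event $\tilde t_n\notin C$ and arbitrary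 on the event $\tilde t_n\in C$. Then $\|\tilde\mu_n-\mu_n\|\to 0$ in probability, that is, $\mathbf P(\|\tilde\mu_n-\mu_n\|\ge\varepsilon)\to 0$ for every $\varepsilon>0$ (in the sense of outer probability if $\tilde\mu_n$ is not measurable). -/

import Mathlib

open MeasureTheory Filter Topology

/-- `y` is a point of `M` at minimal distance from `x`, i.e. a minimiser over `M` of the distance
(equivalently of the squared distance) to `x`. -/
def IsNearestPoint {s : ℕ} (M : Set (EuclideanSpace ℝ (Fin s))) (x y : EuclideanSpace ℝ (Fin s)) :
    Prop :=
  y ∈ M ∧ ∀ z ∈ M, ‖y - x‖ ^ 2 ≤ ‖z - x‖ ^ 2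

/-- The nearest-point mapping: the nearest point of `M` where it is unique (and a selection of a
nearest point where there are several). -/
noncomputable def nearestPoint {s : ℕ} (M : Set (EuclideanSpace ℝ (Fin s)))
    (x : EuclideanSpace ℝ (Fin s)) : EuclideanSpace ℝ (Fin s) :=
  Classical.epsilon (IsNearestPoint M x)

/-- `φ`, restricted to the open set `V ⊆ ℝᵐ`, is a smooth local parametrisation of `M ⊆ ℝˢ`: an
immersion that is a homeomorphism onto a relatively open subset of `M`. -/
structure IsLocalParam {s : ℕ} (m : ℕ) (M : Set (EuclideanSpace ℝ (Fin s)))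
    (φ : EuclideanSpace ℝ (Fin m) → EuclideanSpace ℝ (Fin s))
    (V : Set (EuclideanSpace ℝ (Fin m))) : Prop where
  isOpen : IsOpen V
  contDiffOn : ContDiffOn ℝ (⊤ : ℕ∞) φ V
  injective_fderiv : ∀ u ∈ V, Function.Injective (fderiv ℝ φ u)
  isEmbedding : IsEmbedding (V.domRestrict φ)
  image_eq : ∃ U : Set (EuclideanSpace ℝ (Fin s)), IsOpen U ∧ φ '' V = M ∩ U

/-- `M` is an `m`-dimensional smooth (embedded) submanifold of `ℝˢ`, without boundary. -/
def IsSubmanifold {s : ℕ} (m : ℕ) (M : Set (EuclideanSpace ℝ (Fin s))) : Prop :=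
  ∀ p ∈ M, ∃ φ V, IsLocalParam m M φ V ∧ p ∈ φ '' V

/-- The second derivative (Hessian) of `f` on the `m`-dimensional submanifold `M` at the point `p`,
computed in a local parametrisation around `p`, is a nondegenerate bilinear form. At a critical
point of `f` on `M`, such as a minimiser, this does not depend on the parametrisation. -/
def NondegenerateHessianAt {s : ℕ} (m : ℕ) (M : Set (EuclideanSpace ℝ (Fin s)))
    (f : EuclideanSpace ℝ (Fin s) → ℝ) (p : EuclideanSpace ℝ (Fin s)) : Prop :=
  ∃ φ V, IsLocalParam m M φ V ∧ ∃ u ∈ V, φ u = p ∧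
    ∀ v, (∀ w, fderiv ℝ (fderiv ℝ (f ∘ φ)) u v w = 0) → v = 0

/-- The cutlocus of the `m`-dimensional submanifold `M`: the points `x` whose nearest point on `M`
is not uniquely defined, or for which the squared distance to `x` on `M` has a degenerate second
derivative at the nearest point. -/
def cutLocus {s : ℕ} (m : ℕ) (M : Set (EuclideanSpace ℝ (Fin s))) :
    Set (EuclideanSpace ℝ (Fin s)) :=
  {x | (¬ ∃! y, IsNearestPoint M x y) ∨
    ¬ NondegenerateHessianAt m M (fun y => ‖y - x‖ ^ 2) (nearestPoint M x)}

/-!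
Since the Hessian is nondegenerate off the cut locus `C`, the implicit function theorem makes the
critical points of the squared distance near a nearest point depend uniquely on the centre. Hence
`C` is closed, and the nearest point `p` of `x` remains a nearest point as the centre moves from `x`
away from `p` along the normal ray, until the ray meets `C`: along the ray `p` stays critical.

If `p` is still a nearest point of `p + a (x - p)`, where `1 < a`, then `M` lies outside the
corresponding ball, and comparing with a nearest point `p'` of `x'` gives
`(a - 1) ‖p' - p‖ ≤ 2 a ‖x' - x‖`. So if the ball of radius `r` around `x` avoids `C`, then
`‖π x' - π x‖ ≤ 2 (1 + d(x, M) / r) ‖x' - x‖` on that ball. By tightness, the random points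
are displaced by `O(‖B n‖)` in probability, which is `o(1)` and `o(r)` for `r = d(t n, C)`.
-/

section CriticalPoints

variable {P E F : Type*} [NormedAddCommGroup P] [NormedSpace ℝ P]
  [NormedAddCommGroup E] [NormedSpace ℝ E] [NormedAddCommGroup F] [NormedSpace ℝ F]

lemma contDiffAt_fderiv_of_uncurry {g : P → E → F} {x : P} {u : E} {k n : WithTop ℕ∞}
    (hg : ContDiffAt ℝ n (Function.uncurry g) (x, u)) (hkn : k + 1 ≤ n) :
    ContDiffAt ℝ k (Function.uncurry fun y => fderiv ℝ (g y)) (x, u) :=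
  ContDiffAt.fderiv (f := fun z : P × E => g z.1) (g := Prod.snd)
    (hg.comp ((x, u), u) (by fun_prop : ContDiffAt ℝ n (fun w : (P × E) × E => (w.1.1, w.2)) _))
    contDiffAt_snd hkn

variable [FiniteDimensional ℝ E] {g : P → E → ℝ} {x : P} {u : E}

lemma isInvertible_of_injective_dual {A : E →L[ℝ] E →L[ℝ] ℝ} (hA : Function.Injective A) :
    A.IsInvertible := by
  have hdim : Module.finrank ℝ E = Module.finrank ℝ (E →L[ℝ] ℝ) := by
    rw [← LinearMap.toContinuousLinearMap.finrank_eq (R := ℝ), Subspace.dual_finrank_eq]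
  exact ⟨(LinearEquiv.ofInjectiveOfFinrankEq A.toLinearMap hA hdim).toContinuousLinearEquiv, rfl⟩

lemma eventually_injective_fderiv_fderiv (hg : ContDiffAt ℝ 2 (Function.uncurry g) (x, u))
    (hnd : Function.Injective (fderiv ℝ (fderiv ℝ (g x)) u)) :
    ∀ᶠ z in 𝓝 (x, u), Function.Injective (fderiv ℝ (fderiv ℝ (g z.1)) z.2) := by
  have hgrad := contDiffAt_fderiv_of_uncurry (k := 1) hg (by norm_num)
  have hhess := contDiffAt_fderiv_of_uncurry (k := 0) hgrad (by norm_num)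
  exact hhess.continuousAt.eventually (ContinuousLinearMap.isOpen_injective.mem_nhds hnd)

lemma exists_eventually_eq_of_fderiv_eq_zero [CompleteSpace P]
    (hg : ContDiffAt ℝ 2 (Function.uncurry g) (x, u)) (hcrit : fderiv ℝ (g x) u = 0)
    (hnd : Function.Injective (fderiv ℝ (fderiv ℝ (g x)) u)) :
    ∃ ψ : P → E, ∀ᶠ z in 𝓝 (x, u), fderiv ℝ (g z.1) z.2 = 0 → ψ z.1 = z.2 := by
  have hstrict := (contDiffAt_fderiv_of_uncurry (k := 1) hg (by norm_num)).hasStrictFDerivAt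
    one_ne_zero
  have hpartial := (hstrict.hasFDerivAt.comp u (hasFDerivAt_prodMk_right x u)).fderiv
  refine ⟨hstrict.implicitFunctionOfProdDomain (isInvertible_of_injective_dual ?_), ?_⟩
  · rwa [← hpartial]
  · filter_upwards [hstrict.eventually_apply_eq_iff_implicitFunctionOfProdDomain _] with z hz h0
    exact hz.1 (h0.trans hcrit.symm)

end CriticalPoints

section SqDistAlong

variable {E F : Type*} [NormedAddCommGroup E] [NormedSpace ℝ E] [NormedAddCommGroup F]
  [InnerProductSpace ℝ F]

/-- The squared distance to `y`, pulled back along a parametrisation `φ`. The centre `y` comes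
first, so that this is a family of functions on the parameter space indexed by the centre. -/
def sqDistAlong (φ : E → F) (y : F) (u : E) : ℝ := ‖φ u - y‖ ^ 2

lemma contDiffAt_uncurry_sqDistAlong {φ : E → F} {u : E} {n : WithTop ℕ∞}
    (hφ : ContDiffAt ℝ n φ u) (x : F) :
    ContDiffAt ℝ n (Function.uncurry (sqDistAlong φ)) (x, u) :=
  ((hφ.comp (x, u) contDiffAt_snd).sub contDiffAt_fst).norm_sq ℝ

lemma fderiv_sqDistAlong_lineMap {φ : E → F} {u : E} (hφ : DifferentiableAt ℝ φ u) (x : F)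
    (a : ℝ) :
    fderiv ℝ (sqDistAlong φ (AffineMap.lineMap (φ u) x a)) u =
      a • fderiv ℝ (sqDistAlong φ x) u := by
  have hderiv (y : F) : fderiv ℝ (sqDistAlong φ y) u =
      2 • (innerSL ℝ (φ u - y)) ∘SL fderiv ℝ φ u := (hφ.hasFDerivAt.sub_const y).norm_sq.fderiv
  have hline : φ u - AffineMap.lineMap (φ u) x a = a • (φ u - x) := by
    rw [AffineMap.lineMap_apply_module']; module
  rw [hderiv, hderiv, hline, map_smul, ContinuousLinearMap.smul_comp, smul_comm]

end SqDistAlong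

namespace IsLocalParam

variable {s m : ℕ} {M : Set (EuclideanSpace ℝ (Fin s))} {x : EuclideanSpace ℝ (Fin s)}
  {φ : EuclideanSpace ℝ (Fin m) → EuclideanSpace ℝ (Fin s)}
  {V : Set (EuclideanSpace ℝ (Fin m))} {u : EuclideanSpace ℝ (Fin m)}

lemma apply_mem (hφ : IsLocalParam m M φ V) (hu : u ∈ V) : φ u ∈ M := by
  obtain ⟨U, -, hU⟩ := hφ.image_eq
  exact (hU.subset (Set.mem_image_of_mem φ hu)).1

lemma contDiffAt_two (hφ : IsLocalParam m M φ V) (hu : u ∈ V) : ContDiffAt ℝ 2 φ u :=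
  (hφ.contDiffOn.contDiffAt (hφ.isOpen.mem_nhds hu)).of_le
    (WithTop.coe_le_coe.2 (le_top : (2 : ℕ∞) ≤ ⊤))

lemma image_mem_nhdsWithin (hφ : IsLocalParam m M φ V) (hu : u ∈ V)
    {N : Set (EuclideanSpace ℝ (Fin m))} (hN : N ∈ 𝓝 u) : φ '' (V ∩ N) ∈ 𝓝[M] φ u := by
  obtain ⟨U, hU, hVU⟩ := hφ.image_eq
  have huU : φ u ∈ U := (hVU.subset (Set.mem_image_of_mem φ hu)).2
  have hmap : map (V.domRestrict φ) (𝓝 ⟨u, hu⟩) = 𝓝[Set.range (V.domRestrict φ)] φ u :=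
    hφ.isEmbedding.map_nhds_eq ⟨u, hu⟩
  rw [Set.range_domRestrict, hVU,
    nhdsWithin_inter_of_mem' (mem_nhdsWithin_of_mem_nhds (hU.mem_nhds huU))] at hmap
  rw [← Subtype.image_preimage_coe, ← Set.image_comp]
  exact hmap ▸ image_mem_map (continuousAt_subtype_val hN)

lemma fderiv_sqDistAlong_eq_zero (hφ : IsLocalParam m M φ V) (hu : u ∈ V)
    (h : IsNearestPoint M x (φ u)) : fderiv ℝ (sqDistAlong φ x) u = 0 := by
  refine IsLocalMin.fderiv_eq_zero ?_
  filter_upwards [hφ.isOpen.mem_nhds hu] with v hv using h.2 _ (hφ.apply_mem hv)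

end IsLocalParam

section NearestPoint

variable {s m : ℕ} {M : Set (EuclideanSpace ℝ (Fin s))} {x p : EuclideanSpace ℝ (Fin s)}

lemma exists_isNearestPoint (hM : IsCompact M) (hne : M.Nonempty)
    (x : EuclideanSpace ℝ (Fin s)) : ∃ p, IsNearestPoint M x p := by
  obtain ⟨p, hp, hmin⟩ := hM.exists_isMinOn hne (f := fun z => ‖z - x‖ ^ 2) (by fun_prop)
  exact ⟨p, hp, hmin⟩

lemma IsNearestPoint.norm_sub_le {z : EuclideanSpace ℝ (Fin s)} (hp : IsNearestPoint M x p)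
    (hz : z ∈ M) : ‖p - x‖ ≤ ‖z - x‖ :=
  le_of_sq_le_sq (hp.2 z hz) (norm_nonneg _)

lemma IsNearestPoint.norm_sub_le_infDist (hp : IsNearestPoint M x p) :
    ‖p - x‖ ≤ Metric.infDist x M :=
  (Metric.le_infDist ⟨p, hp.1⟩).2 fun _ hz =>
    (hp.norm_sub_le hz).trans_eq (dist_eq_norm_sub' ..).symm

lemma isNearestPoint_iff_inner : IsNearestPoint M x p ↔
    p ∈ M ∧ ∀ z ∈ M, 2 * inner ℝ (x - p) (z - p) ≤ ‖z - p‖ ^ 2 := by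
  refine and_congr_right fun _ => forall₂_congr fun z _ => ?_
  rw [← sub_sub_sub_cancel_right z x p, norm_sub_sq_real (z - p) (x - p),
    norm_sub_rev p x, real_inner_comm]
  constructor <;> intro h <;> linarith

lemma isNearestPoint_lineMap_iff {a : ℝ} : IsNearestPoint M (AffineMap.lineMap p x a) p ↔
    p ∈ M ∧ ∀ z ∈ M, 2 * a * inner ℝ (x - p) (z - p) ≤ ‖z - p‖ ^ 2 := by
  simp only [isNearestPoint_iff_inner, AffineMap.lineMap_apply_module', add_sub_cancel_right,
    real_inner_smul_left, mul_assoc]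

lemma eventually_isNearestPoint_mem (hM : IsCompact M)
    (huniq : ∀ q, IsNearestPoint M x q → q = p) {U : Set (EuclideanSpace ℝ (Fin s))}
    (hU : U ∈ 𝓝[M] p) : ∀ᶠ y in 𝓝 x, ∀ q, IsNearestPoint M y q → q ∈ U := by
  obtain ⟨O, hO, hpO, hOU⟩ := mem_nhdsWithin.1 hU
  have hfar : ∀ᶠ y in 𝓝 x, ∀ z ∈ M \ O, ∃ w ∈ M, ‖w - y‖ ^ 2 < ‖z - y‖ ^ 2 := by
    refine (hM.diff hO).eventually_forall_of_forall_eventually fun z hz => ?_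
    have hz' : ¬ IsNearestPoint M x z := fun h => hz.2 (huniq z h ▸ hpO)
    obtain ⟨w, hw, hlt⟩ : ∃ w ∈ M, ‖w - x‖ ^ 2 < ‖z - x‖ ^ 2 := by
      simpa [IsNearestPoint, hz.1] using hz'
    have hopen : IsOpen {v : EuclideanSpace ℝ (Fin s) × EuclideanSpace ℝ (Fin s) |
        ‖w - v.1‖ ^ 2 < ‖v.2 - v.1‖ ^ 2} := isOpen_lt (by fun_prop) (by fun_prop)
    filter_upwards [hopen.mem_nhds (show (x, z) ∈ _ from hlt)] with v hv using ⟨w, hw, hv⟩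
  filter_upwards [hfar] with y hy q hq
  by_contra hqU
  obtain ⟨w, hw, hlt⟩ := hy q ⟨hq.1, fun hqO => hqU (hOU ⟨hqO, hq.1⟩)⟩
  exact (hq.2 w hw).not_gt hlt

lemma IsLocalParam.eventually_forall_isNearestPoint
    {φ : EuclideanSpace ℝ (Fin m) → EuclideanSpace ℝ (Fin s)}
    {V : Set (EuclideanSpace ℝ (Fin m))} {u : EuclideanSpace ℝ (Fin m)}
    (hφ : IsLocalParam m M φ V) (hu : u ∈ V) (hM : IsCompact M)
    (huniq : ∀ q, IsNearestPoint M x q → q = φ u)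
    {Q : EuclideanSpace ℝ (Fin s) × EuclideanSpace ℝ (Fin m) → Prop}
    (hQ : ∀ᶠ z in 𝓝 (x, u), Q z) :
    ∀ᶠ y in 𝓝 x, ∀ q, IsNearestPoint M y q → ∃ v ∈ V, φ v = q ∧ Q (y, v) := by
  rw [nhds_prod_eq] at hQ
  obtain ⟨A, hA, B, hB, hAB⟩ := eventually_prod_iff.1 hQ
  filter_upwards [hA, eventually_isNearestPoint_mem hM huniq (hφ.image_mem_nhdsWithin hu hB)]
    with y hy hnear q hq
  obtain ⟨v, ⟨hv, hvB⟩, rfl⟩ := hnear q hq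
  exact ⟨v, hv, rfl, hAB hy hvB⟩

end NearestPoint

section CutLocus

variable {s m : ℕ} {M : Set (EuclideanSpace ℝ (Fin s))} {x p : EuclideanSpace ℝ (Fin s)}

lemma notMem_cutLocus_iff : x ∉ cutLocus m M ↔ ∃ p, IsNearestPoint M x p ∧
    (∀ q, IsNearestPoint M x q → q = p) ∧
      NondegenerateHessianAt m M (fun y => ‖y - x‖ ^ 2) p := by
  have hnear {p} (hp : IsNearestPoint M x p) (huniq : ∀ q, IsNearestPoint M x q → q = p) :
      nearestPoint M x = p := huniq _ (Classical.epsilon_spec ⟨p, hp⟩)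
  simp only [cutLocus, Set.mem_ofPred_eq, not_or, not_not]
  constructor
  · rintro ⟨⟨p, hp, huniq⟩, hnd⟩
    exact ⟨p, hp, huniq, hnear hp huniq ▸ hnd⟩
  · rintro ⟨p, hp, huniq, hnd⟩
    exact ⟨⟨p, hp, huniq⟩, (hnear hp huniq).symm ▸ hnd⟩

lemma isNearestPoint_nearestPoint (hx : x ∉ cutLocus m M) :
    IsNearestPoint M x (nearestPoint M x) :=
  let ⟨_, hp, _⟩ := notMem_cutLocus_iff.1 hx
  Classical.epsilon_spec ⟨_, hp⟩

lemma nondegenerateHessianAt_sqDist_iff :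
    NondegenerateHessianAt m M (fun y => ‖y - x‖ ^ 2) p ↔ ∃ φ V, IsLocalParam m M φ V ∧
      ∃ u ∈ V, φ u = p ∧ Function.Injective (fderiv ℝ (fderiv ℝ (sqDistAlong φ x)) u) := by
  simp only [injective_iff_map_eq_zero, ContinuousLinearMap.ext_iff]
  rfl

lemma isClosed_cutLocus (hM : IsCompact M) : IsClosed (cutLocus m M) := by
  rw [← isOpen_compl_iff, isOpen_iff_eventually]
  intro x hx
  obtain ⟨p, hp, huniq, hnd⟩ := notMem_cutLocus_iff.1 hx
  obtain ⟨φ, V, hφ, u, hu, rfl, hinj⟩ := nondegenerateHessianAt_sqDist_iff.1 hnd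
  have hsmooth := contDiffAt_uncurry_sqDistAlong (hφ.contDiffAt_two hu) x
  obtain ⟨ψ, hψ⟩ := exists_eventually_eq_of_fderiv_eq_zero hsmooth
    (hφ.fderiv_sqDistAlong_eq_zero hu hp) hinj
  filter_upwards [hφ.eventually_forall_isNearestPoint hu hM huniq
    (hψ.and (eventually_injective_fderiv_fderiv hsmooth hinj))] with y hy
  have hψ_eq (q) (hq : IsNearestPoint M y q) : φ (ψ y) = q := by
    obtain ⟨v, hv, rfl, hψv, -⟩ := hy q hq
    rw [hψv (hφ.fderiv_sqDistAlong_eq_zero hv hq)]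
  obtain ⟨q, hq⟩ := exists_isNearestPoint hM ⟨_, hp.1⟩ y
  obtain ⟨v, hv, hvq, -, hinj'⟩ := hy q hq
  exact notMem_cutLocus_iff.2 ⟨q, hq, fun q' hq' => (hψ_eq q' hq').symm.trans (hψ_eq q hq),
    nondegenerateHessianAt_sqDist_iff.2 ⟨φ, V, hφ, v, hv, hvq, hinj'⟩⟩

lemma eventually_isNearestPoint_lineMap (hM : IsCompact M) {a₀ : ℝ} (ha₀ : a₀ ≠ 0)
    (hC : AffineMap.lineMap p x a₀ ∉ cutLocus m M)
    (hp : IsNearestPoint M (AffineMap.lineMap p x a₀) p) :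
    ∀ᶠ a in 𝓝 a₀, IsNearestPoint M (AffineMap.lineMap p x a) p := by
  obtain ⟨p', -, huniq, hnd⟩ := notMem_cutLocus_iff.1 hC
  obtain rfl := huniq p hp
  obtain ⟨φ, V, hφ, u, hu, rfl, hinj⟩ := nondegenerateHessianAt_sqDist_iff.1 hnd
  have hdiff : DifferentiableAt ℝ φ u := (hφ.contDiffAt_two hu).differentiableAt two_ne_zero
  have hcrit₀ := hφ.fderiv_sqDistAlong_eq_zero hu hp
  have hcrit (a : ℝ) : fderiv ℝ (sqDistAlong φ (AffineMap.lineMap (φ u) x a)) u = 0 := by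
    rw [fderiv_sqDistAlong_lineMap hdiff, smul_eq_zero_iff_right ha₀] at hcrit₀
    rw [fderiv_sqDistAlong_lineMap hdiff, hcrit₀, smul_zero]
  obtain ⟨ψ, hψ⟩ := exists_eventually_eq_of_fderiv_eq_zero
    (contDiffAt_uncurry_sqDistAlong (hφ.contDiffAt_two hu) _) hcrit₀ hinj
  have hline : ContinuousAt (AffineMap.lineMap (φ u) x : ℝ → _) a₀ := by fun_prop
  have hpair := hline.prodMk (continuousAt_const (y := u))
  filter_upwards [hline.eventually (hφ.eventually_forall_isNearestPoint hu hM huniq hψ),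
    hpair.eventually hψ] with a hnear hψu
  obtain ⟨q, hq⟩ := exists_isNearestPoint hM ⟨_, hp.1⟩ (AffineMap.lineMap (φ u) x a)
  obtain ⟨v, hv, rfl, hψv⟩ := hnear q hq
  have hvu : v = u := (hψv (hφ.fderiv_sqDistAlong_eq_zero hv hq)).symm.trans (hψu (hcrit a))
  rwa [hvu] at hq

lemma IsNearestPoint.lineMap_of_notMem_cutLocus (hM : IsCompact M) (hp : IsNearestPoint M x p)
    {a : ℝ} (ha : 1 ≤ a) (hC : ∀ b ∈ Set.Ico 1 a, AffineMap.lineMap p x b ∉ cutLocus m M) :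
    IsNearestPoint M (AffineMap.lineMap p x a) p := by
  have hclosed : IsClosed {b : ℝ | IsNearestPoint M (AffineMap.lineMap p x b) p} := by
    simp only [isNearestPoint_lineMap_iff, hp.1, true_and, Set.ofPred_forall]
    exact isClosed_biInter fun z _ => isClosed_le (by fun_prop) (by fun_prop)
  refine (hclosed.inter isClosed_Icc).Icc_subset_of_forall_mem_nhdsWithin ?_ ?_
    (Set.right_mem_Icc.2 ha)
  · simpa using hp
  · rintro b ⟨hb, hb1⟩
    exact mem_nhdsWithin_of_mem_nhds (eventually_isNearestPoint_lineMap hM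
      (zero_lt_one.trans_le hb1.1).ne' (hC b hb1) hb)

end CutLocus

section Stability

variable {s m : ℕ} {M : Set (EuclideanSpace ℝ (Fin s))} {x p x' p' : EuclideanSpace ℝ (Fin s)}

lemma IsNearestPoint.mul_norm_sub_le {a : ℝ} (ha : 0 ≤ a)
    (hp : IsNearestPoint M (AffineMap.lineMap p x a) p) (hp' : IsNearestPoint M x' p') :
    (a - 1) * ‖p' - p‖ ≤ 2 * a * ‖x' - x‖ := by
  rcases eq_or_ne p' p with rfl | hne
  · simpa using by positivity
  have hray : 2 * a * inner ℝ (x - p) (p' - p) ≤ ‖p' - p‖ ^ 2 :=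
    (isNearestPoint_lineMap_iff.1 hp).2 p' hp'.1
  have hperturbed :
      ‖p' - p‖ ^ 2 ≤ 2 * inner ℝ (x' - x) (p' - p) + 2 * inner ℝ (x - p) (p' - p) := by
    have h := (isNearestPoint_iff_inner.1 hp').2 p hp.1
    have hsplit : inner ℝ (x' - p') (p - p') =
        ‖p' - p‖ ^ 2 - inner ℝ (x' - x) (p' - p) - inner ℝ (x - p) (p' - p) := by
      rw [← real_inner_self_eq_norm_sq, ← inner_sub_left, ← inner_sub_left, ← inner_neg_neg]
      congr 1 <;> abel
    rw [hsplit, norm_sub_rev p p'] at h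
    linarith
  have hsq : ((a - 1) * ‖p' - p‖) * ‖p' - p‖ ≤ (2 * a * ‖x' - x‖) * ‖p' - p‖ :=
    calc (a - 1) * ‖p' - p‖ * ‖p' - p‖
      _ = a * ‖p' - p‖ ^ 2 - ‖p' - p‖ ^ 2 := by ring
      _ ≤ 2 * a * inner ℝ (x' - x) (p' - p) := by
        linarith [mul_le_mul_of_nonneg_left hperturbed ha]
      _ ≤ 2 * a * (‖x' - x‖ * ‖p' - p‖) := by gcongr; exact real_inner_le_norm _ _
      _ = _ := by ring
  exact le_of_mul_le_mul_right hsq (norm_sub_pos_iff.2 hne)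

lemma IsNearestPoint.mul_norm_sub_le_of_disjoint_ball (hM : IsCompact M)
    (hp : IsNearestPoint M x p) (hp' : IsNearestPoint M x' p') {r : ℝ} (hr : 0 ≤ r)
    (hC : Disjoint (Metric.ball x r) (cutLocus m M)) :
    r * ‖p' - p‖ ≤ 2 * (r + Metric.infDist x M) * ‖x' - x‖ := by
  refine le_trans ?_ (mul_le_mul_of_nonneg_right
    (mul_le_mul_of_nonneg_left (add_le_add_right hp.norm_sub_le_infDist r) two_pos.le)
    (norm_nonneg _))
  rcases eq_or_ne p x with rfl | hpx
  · have hdist : ‖p' - p‖ ≤ 2 * ‖x' - p‖ :=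
      calc ‖p' - p‖ ≤ ‖p' - x'‖ + ‖x' - p‖ := norm_sub_le_norm_sub_add_norm_sub ..
        _ ≤ ‖p - x'‖ + ‖x' - p‖ := by gcongr; exact hp'.norm_sub_le hp.1
        _ = 2 * ‖x' - p‖ := by rw [norm_sub_rev p x', two_mul]
    calc r * ‖p' - p‖ ≤ r * (2 * ‖x' - p‖) := by gcongr
      _ = 2 * (r + ‖p - p‖) * ‖x' - p‖ := by rw [sub_self, norm_zero]; ring
  have hpos : 0 < ‖p - x‖ := norm_sub_pos_iff.2 hpx
  have hray : IsNearestPoint M (AffineMap.lineMap p x (1 + r / ‖p - x‖)) p := by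
    refine hp.lineMap_of_notMem_cutLocus hM (by simpa using by positivity) fun b hb hmem =>
      hC.notMem_of_mem_left ?_ hmem
    rw [Metric.mem_ball, dist_lineMap_right, dist_eq_norm, Real.norm_eq_abs, abs_sub_comm,
      abs_of_nonneg (sub_nonneg.2 hb.1), ← lt_div_iff₀ hpos]
    linarith [hb.2]
  have hstab := hray.mul_norm_sub_le (by positivity) hp'
  calc r * ‖p' - p‖ = ‖p - x‖ * ((1 + r / ‖p - x‖ - 1) * ‖p' - p‖) := by field_simp; ring
    _ ≤ ‖p - x‖ * (2 * (1 + r / ‖p - x‖) * ‖x' - x‖) := by gcongr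
    _ = 2 * (r + ‖p - x‖) * ‖x' - x‖ := by field_simp; ring

lemma norm_nearestPoint_sub_le (hM : IsCompact M) {r : ℝ}
    (hC : Disjoint (Metric.ball x r) (cutLocus m M)) (hx' : x' ∈ Metric.ball x r) :
    ‖nearestPoint M x' - nearestPoint M x‖ ≤ 2 * (1 + Metric.infDist x M / r) * ‖x' - x‖ := by
  have hr : 0 < r := dist_nonneg.trans_lt hx'
  have hx : x ∈ Metric.ball x r := Metric.mem_ball_self hr
  have hstab :=
    (isNearestPoint_nearestPoint (hC.notMem_of_mem_left hx)).mul_norm_sub_le_of_disjoint_ball hM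
      (isNearestPoint_nearestPoint (hC.notMem_of_mem_left hx')) hr.le hC
  refine le_of_mul_le_mul_left (hstab.trans_eq ?_) hr
  field_simp

end Stability

section Tightness

variable {ι E Ω' : Type*} {l : Filter ι} [NormedAddCommGroup E] [MeasurableSpace E]
  [OpensMeasurableSpace E] {Ω : ι → Type*} [∀ n, MeasurableSpace (Ω n)]
  {P : ∀ n, Measure (Ω n)} [∀ n, IsProbabilityMeasure (P n)] [MeasurableSpace Ω']
  {P' : Measure Ω'} [IsProbabilityMeasure P'] {X : ∀ n, Ω n → E} {Z : Ω' → E}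

lemma exists_eventually_measure_le_norm_lt (hX : TendstoInDistribution X l Z P P')
    {η : ENNReal} (hη : 0 < η) : ∃ K : ℝ, ∀ᶠ n in l, P n {ω | K ≤ ‖X n ω‖} < η := by
  have hnorm := hX.continuous_comp continuous_norm
  obtain ⟨K, hK⟩ : ∃ K : ℝ, P'.map (norm ∘ Z) {y | K < ‖y‖} < η := by
    have := Measure.isProbabilityMeasure_map hnorm.aemeasurable_limit
    have htight := tendsto_measure_norm_gt_of_isTightMeasureSet
      (isTightMeasureSet_singleton (μ := P'.map (norm ∘ Z)))
    simp only [Set.mem_singleton_iff, iSup_iSup_eq_left] at htight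
    exact (htight.eventually_lt_const hη).exists
  have hclosed : IsClosed {y : ℝ | K + 1 ≤ ‖y‖} := isClosed_le continuous_const continuous_norm
  have hlimsup := ProbabilityMeasure.limsup_measure_closed_le_of_tendsto hnorm.tendsto hclosed
  have hlt : P'.map (norm ∘ Z) {y | K + 1 ≤ ‖y‖} < η :=
    (measure_mono fun y hy => (lt_add_one K).trans_le hy).trans_lt hK
  refine ⟨K + 1, (eventually_lt_of_limsup_lt (hlimsup.trans_lt hlt)).mono fun n hn => ?_⟩
  rw [ProbabilityMeasure.coe_mk, Measure.map_apply_of_aemeasurable (hnorm.forall_aemeasurable n)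
    hclosed.measurableSet] at hn
  simpa using hn

lemma tendsto_measure_le_mul_norm (hX : TendstoInDistribution X l Z P P') {c : ι → ℝ}
    (hc : Tendsto c l (𝓝 0)) {δ : ℝ} (hδ : 0 < δ) :
    Tendsto (fun n => P n {ω | δ ≤ c n * ‖X n ω‖}) l (𝓝 0) := by
  refine ENNReal.tendsto_nhds_zero.2 fun η hη => ?_
  obtain ⟨K, hK⟩ := exists_eventually_measure_le_norm_lt hX hη
  have hsmall : ∀ᶠ n in l, |c n| * max K 0 < δ :=
    Tendsto.eventually_lt_const (by simpa using hδ)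
      (by simpa using hc.abs.mul_const (max K 0))
  filter_upwards [hK, hsmall] with n hKn hcn
  refine (measure_mono fun ω hω => ?_).trans hKn.le
  by_contra hlt
  have hXK : ‖X n ω‖ ≤ max K 0 := (not_le.1 hlt).le.trans (le_max_left ..)
  refine (show δ ≤ c n * ‖X n ω‖ from hω).not_gt (lt_of_le_of_lt ?_ hcn)
  exact mul_le_mul (le_abs_self _) hXK (norm_nonneg _) (abs_nonneg _)

end Tightness

lemma tendsto_norm_toEuclideanCLM {𝕜 ι n : Type*} [RCLike 𝕜] [Fintype n] [DecidableEq n]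
    {l : Filter ι} {B : ι → Matrix n n 𝕜} (hB : Tendsto B l (𝓝 0)) :
    Tendsto (fun i => ‖Matrix.toEuclideanCLM (𝕜 := 𝕜) (B i)‖) l (𝓝 0) := by
  have hcont : Continuous (Matrix.toEuclideanCLM (n := n) (𝕜 := 𝕜)) :=
    LinearMap.continuous_of_finiteDimensional
      (Matrix.toEuclideanCLM (n := n) (𝕜 := 𝕜)).toAlgEquiv.toLinearMap
  simpa [Function.comp_def] using (hcont.norm.tendsto 0).comp hB

section Consistency

variable {s m : ℕ} {M : Set (EuclideanSpace ℝ (Fin s))} {ι Ω' : Type*} {l : Filter ι}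
  {Ω : ι → Type*} [∀ n, MeasurableSpace (Ω n)]
  {P : ∀ n, Measure (Ω n)} [∀ n, IsProbabilityMeasure (P n)] [MeasurableSpace Ω']
  {P' : Measure Ω'} [IsProbabilityMeasure P'] {t : ι → EuclideanSpace ℝ (Fin s)}
  {tt μt : ∀ n, Ω n → EuclideanSpace ℝ (Fin s)}

lemma tendsto_measure_le_norm_sub_nearestPoint {F : Type*} [NormedAddCommGroup F]
    [NormedSpace ℝ F] [MeasurableSpace F] [OpensMeasurableSpace F] {X : ∀ n, Ω n → F} {Z : Ω' → F}
    (hM : IsCompact M) (hX : TendstoInDistribution X l Z P P')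
    {T : ι → F →L[ℝ] EuclideanSpace ℝ (Fin s)} (hT : ∀ n ω, tt n ω - t n = T n (X n ω))
    (hT₀ : Tendsto (fun n => ‖T n‖) l (𝓝 0)) {r : ι → ℝ} (hr : ∀ n, 0 < r n)
    (hrC : ∀ n, Disjoint (Metric.ball (t n) (r n)) (cutLocus m M))
    (hTr : Tendsto (fun n => ‖T n‖ / r n) l (𝓝 0)) {D : ℝ}
    (hD : ∀ n, Metric.infDist (t n) M ≤ D)
    (hμt : ∀ n ω, tt n ω ∉ cutLocus m M → μt n ω = nearestPoint M (tt n ω)) {ε : ℝ} (hε : 0 < ε) :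
    Tendsto (fun n => P n {ω | ε ≤ ‖μt n ω - nearestPoint M (t n)‖}) l (𝓝 0) := by
  have hescape : Tendsto (fun n => P n {ω | 1 ≤ ‖T n‖ / r n * ‖X n ω‖}) l (𝓝 0) :=
    tendsto_measure_le_mul_norm hX hTr one_pos
  have hstretch : Tendsto
      (fun n => P n {ω | ε ≤ 2 * (‖T n‖ + D * (‖T n‖ / r n)) * ‖X n ω‖}) l (𝓝 0) :=
    tendsto_measure_le_mul_norm hX (by simpa using (hT₀.add (hTr.const_mul D)).const_mul 2) hε
  refine tendsto_of_tendsto_of_tendsto_of_le_of_le tendsto_const_nhds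
    (by simpa using hescape.add hstretch) (fun n => zero_le) fun n => ?_
  refine (measure_mono fun ω hω => ?_).trans (measure_union_le _ _)
  refine or_iff_not_imp_left.2 fun hnear => le_trans (Set.mem_ofPred_eq ▸ hω) ?_
  have hrn := hr n
  have hD₀ : 0 ≤ D := Metric.infDist_nonneg.trans (hD n)
  have hdisp : ‖tt n ω - t n‖ ≤ ‖T n‖ * ‖X n ω‖ := hT n ω ▸ (T n).le_opNorm _
  have hball : tt n ω ∈ Metric.ball (t n) (r n) := by
    rw [Set.mem_ofPred_eq, not_le, div_mul_eq_mul_div, div_lt_one hrn] at hnear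
    exact mem_ball_iff_norm.2 (hdisp.trans_lt hnear)
  rw [hμt n ω ((hrC n).notMem_of_mem_left hball)]
  calc ‖nearestPoint M (tt n ω) - nearestPoint M (t n)‖
    _ ≤ 2 * (1 + Metric.infDist (t n) M / r n) * ‖tt n ω - t n‖ :=
      norm_nearestPoint_sub_le hM (hrC n) hball
    _ ≤ 2 * (1 + D / r n) * (‖T n‖ * ‖X n ω‖) := by gcongr; exact hD n
    _ = 2 * (‖T n‖ + D * (‖T n‖ / r n)) * ‖X n ω‖ := by ring

theorem theorem2p1_general {Z : Ω' → EuclideanSpace ℝ (Fin s)} (hM : IsCompact M)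
    {B : ι → Matrix (Fin s) (Fin s) ℝ} (hBdet : ∀ n, IsUnit (B n).det) (hB : Tendsto B l (𝓝 0))
    (hZ : TendstoInDistribution
      (fun n ω => Matrix.toEuclideanCLM (n := Fin s) (𝕜 := ℝ) (B n)⁻¹ (tt n ω - t n)) l Z P P')
    (ht : ∀ n, t n ∉ cutLocus m M) {D : ℝ} (htD : ∀ n, Metric.infDist (t n) M ≤ D)
    (hBC : Tendsto (fun n => (Metric.infDist (t n) (cutLocus m M))⁻¹ • B n) l (𝓝 0))
    (hμt : ∀ n ω, tt n ω ∉ cutLocus m M → μt n ω = nearestPoint M (tt n ω)) {ε : ℝ} (hε : 0 < ε) :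
    Tendsto (fun n => P n {ω | ε ≤ ‖μt n ω - nearestPoint M (t n)‖}) l (𝓝 0) := by
  have hrescale (n ω) : tt n ω - t n =
      Matrix.toEuclideanCLM (n := Fin s) (𝕜 := ℝ) (B n)
        (Matrix.toEuclideanCLM (n := Fin s) (𝕜 := ℝ) (B n)⁻¹ (tt n ω - t n)) := by
    rw [← mul_apply_eq_comp, ← map_mul, Matrix.mul_nonsing_inv _ (hBdet n),
      map_one, one_apply_eq_self]
  have hnorm := tendsto_norm_toEuclideanCLM hB
  -- `Metric.infDist` to the empty set is `0`, so an empty cut locus needs another choice of radius.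
  rcases (cutLocus m M).eq_empty_or_nonempty with hC | hC
  · exact tendsto_measure_le_norm_sub_nearestPoint hM hZ hrescale hnorm (r := fun _ => 1)
      (fun _ => one_pos) (fun _ => hC ▸ Set.disjoint_empty _) (by simpa using hnorm) htD hμt hε
  · have hpos (n) : 0 < Metric.infDist (t n) (cutLocus m M) :=
      ((isClosed_cutLocus hM).notMem_iff_infDist_pos hC).1 (ht n)
    refine tendsto_measure_le_norm_sub_nearestPoint hM hZ hrescale hnorm hpos
      (fun _ => Metric.disjoint_ball_infDist) ?_ htD hμt hε
    convert tendsto_norm_toEuclideanCLM hBC using 2 with n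
    rw [map_smul, norm_smul, norm_inv, Real.norm_of_nonneg (hpos n).le, div_eq_inv_mul]

end Consistency

/-- The random vectors `tt n` may live on different probability spaces, and `μt n`, the projected
estimator, is arbitrary on the event that `tt n` lies in the cutlocus. If the cutlocus is empty
(its distance being `+∞` by convention, and `0` for `Metric.infDist`), the rate condition holds
automatically under both conventions. -/
theorem theorem2p1 {s m : ℕ} (M : Set (EuclideanSpace ℝ (Fin s)))
    (hMc : IsCompact M) (hM : IsSubmanifold m M)
    {Ω : ℕ → Type*} [∀ n, MeasurableSpace (Ω n)]
    (P : ∀ n, Measure (Ω n)) [∀ n, IsProbabilityMeasure (P n)]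
    {Ω' : Type*} [MeasurableSpace Ω'] (P' : Measure Ω') [IsProbabilityMeasure P']
    (t : ℕ → EuclideanSpace ℝ (Fin s))
    (tt : ∀ n, Ω n → EuclideanSpace ℝ (Fin s))
    (Z : Ω' → EuclideanSpace ℝ (Fin s))
    (B : ℕ → Matrix (Fin s) (Fin s) ℝ)
    (hBdet : ∀ n, IsUnit (B n).det)
    (hB : Tendsto B atTop (𝓝 0))
    (hZ : TendstoInDistribution
      (fun n ω => Matrix.toEuclideanCLM (n := Fin s) (𝕜 := ℝ) (B n)⁻¹ (tt n ω - t n))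
      atTop Z P P')
    (ht : ∀ n, t n ∉ cutLocus m M)
    (D : ℝ) (hD : 0 < D) (htD : ∀ n, Metric.infDist (t n) M ≤ D)
    (hBC : Tendsto (fun n => (Metric.infDist (t n) (cutLocus m M))⁻¹ • B n) atTop (𝓝 0))
    (μt : ∀ n, Ω n → EuclideanSpace ℝ (Fin s))
    (hμt : ∀ n ω, tt n ω ∉ cutLocus m M → μt n ω = nearestPoint M (tt n ω)) :
    ∀ ε : ℝ, 0 < ε →
      Tendsto (fun n => P n {ω | ε ≤ ‖μt n ω - nearestPoint M (t n)‖}) atTop (𝓝 0) := by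
  exact fun _ hε => theorem2p1_general hMc hBdet hB hZ ht htD hBC hμt hε
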